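/- Let $G$ be a finite simple undirected graph with $m \ge 57$ edges and no isolated vertices. Let $\theta_{2,2,3}$ be the graph consisting of two distinct vertices joined by three internally disjoint paths of lengths $2$, $2$ and $3$ (so it has $6$ vertices and $7$ edges), and suppose that $G$ does not contain $\theta_{2,2,3}$ as a (not necessarily induced) subgraph. Let $\lambda(G)$ be the largest eigenvalue of the adjacency matrix of $G$. Then $$\lambda(G) \le \frac{1+\sqrt{4m-3}}{2},$$ and equality holds if and only if $m$ is odd and $G$ is isomorphic to $K_2 \vee \frac{m-1}{2} K_1$, the graph obtained from an edge and $\frac{m-1}{2}$ further vertices by joining each of these further vertices to both ends of the edge. -/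

import Mathlib

/-- The set of (real) eigenvalues of the adjacency matrix of a finite graph. -/
def adjEigenvalues {V : Type*} [Fintype V] [DecidableEq V] (G : SimpleGraph V)
    [DecidableRel G.Adj] : Set ℝ :=
  {μ : ℝ | Module.End.HasEigenvalue (Matrix.toLin' (G.adjMatrix ℝ)) μ}

/-- The spectral radius of a finite graph: the largest eigenvalue of its adjacency matrix. -/
noncomputable def graphSpectralRadius {V : Type*} [Fintype V] [DecidableEq V]
    (G : SimpleGraph V) [DecidableRel G.Adj] : ℝ :=
  sSup (adjEigenvalues G)

/-- The supremum above is attained: it is the largest adjacency eigenvalue. -/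
theorem isGreatest_graphSpectralRadius {V : Type*} [Fintype V] [DecidableEq V] [Nonempty V]
    (G : SimpleGraph V) [DecidableRel G.Adj] :
    IsGreatest (adjEigenvalues G) (graphSpectralRadius G) := by
  have hfin : (adjEigenvalues G).Finite :=
    Module.End.finite_hasEigenvalue (Matrix.toLin' (G.adjMatrix ℝ))
  have hA : (G.adjMatrix ℝ).IsHermitian := by
    rw [Matrix.IsHermitian, Matrix.conjTranspose_eq_transpose_of_trivial]
    exact G.isSymm_adjMatrix
  have hne : (adjEigenvalues G).Nonempty := by
    obtain ⟨v⟩ := ‹Nonempty V›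
    refine ⟨hA.eigenvalues v, ?_⟩
    have h := hA.eigenvalues_mem_spectrum_real v
    rw [← Matrix.spectrum_toLin'] at h
    exact Module.End.hasEigenvalue_iff_mem_spectrum.mpr h
  exact ⟨hne.csSup_mem hfin, fun x hx => le_csSup hfin.bddAbove hx⟩

/-- The theta graph `θ_{2,2,3}`: the vertices `0` and `1` are joined by the internally disjoint
paths `0 - 2 - 1`, `0 - 3 - 1` and `0 - 4 - 5 - 1`. -/
def theta223 : SimpleGraph (Fin 6) :=
  SimpleGraph.fromEdgeSet {s(0, 2), s(2, 1), s(0, 3), s(3, 1), s(0, 4), s(4, 5), s(5, 1)}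

/-- The join `G ∨ H`: the disjoint union of `G` and `H` together with all edges between them. -/
def graphJoin {V W : Type*} (G : SimpleGraph V) (H : SimpleGraph W) : SimpleGraph (V ⊕ W) :=
  (G ⊕g H) ⊔ completeBipartiteGraph V W

/-- The book graph `K_2 ∨ k K_1`: `k` triangles sharing one edge. -/
def bookGraph (k : ℕ) : SimpleGraph (Fin 2 ⊕ Fin k) :=
  graphJoin (⊤ : SimpleGraph (Fin 2)) (⊥ : SimpleGraph (Fin k))

/-! Take a nonnegative eigenvector `x` for `r = λ(G)`, scaled to have maximum `x u = 1`. Evaluating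
`A²x - Ax` at `u` gives `r² - r = m -` (a sum of local terms over `N(u)` and over the vertices far
from `u`), see `sq_sub_self_eq_of_eigenvector`. The goal is that these terms cost at least 1 in
total.

Since `G` is θ-free, a vertex with at least four neighbours inside `N(u)` is the centre of a star
component of `G[N(u)]`. A centre costs at least 1 and its leaves cost nothing. The other components
have degrees at most 3; their terms can be negative, and are repaired by adding 2/5 of the
eigenvalue equations over `smallPart`, at the expense of the far vertices (`sq_sub_self_le`). For `r
≥ 8` every cost is then nonnegative. Without a centre the total is at least `∑ x v = r > 1`; with
one it is at least 1, and equality leaves a single star and no far vertex, that is, a book. -/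

theorem exists_nonneg_eigenvector_graphSpectralRadius {V : Type*} [Fintype V] [DecidableEq V]
    [Nonempty V] (G : SimpleGraph V) [DecidableRel G.Adj] :
    ∃ (x : V → ℝ) (u : V), (∀ v, 0 ≤ x v) ∧ (∀ v, x v ≤ 1) ∧ x u = 1 ∧
      ∀ v, ∑ w, G.adjMatrix ℝ v w * x w = graphSpectralRadius G * x v := by
  set r := graphSpectralRadius G with hr
  set A := G.adjMatrix ℝ with hA
  have hgr := isGreatest_graphSpectralRadius G
  have hherm : (r • (1 : Matrix V V ℝ) - A).IsHermitian := by
    rw [Matrix.IsHermitian, Matrix.conjTranspose_eq_transpose_of_trivial, Matrix.transpose_sub,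
      Matrix.transpose_smul, Matrix.transpose_one, SimpleGraph.transpose_adjMatrix]
  have hpsd : (r • (1 : Matrix V V ℝ) - A).PosSemidef := by
    rw [hherm.posSemidef_iff_eigenvalues_nonneg]
    intro i
    have h := hherm.mulVec_eigenvectorBasis i
    have hne : (hherm.eigenvectorBasis i).ofLp ≠ 0 := by
      intro h0
      exact hherm.eigenvectorBasis.orthonormal.ne_zero i (by ext j; exact congrFun h0 j)
    have hmem : r - hherm.eigenvalues i ∈ adjEigenvalues G := by
      refine Module.End.hasEigenvalue_of_hasEigenvector (x := (hherm.eigenvectorBasis i).ofLp)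
        ⟨Module.End.mem_eigenspace_iff.2 ?_, hne⟩
      rw [Matrix.toLin'_apply, sub_smul, ← h, Matrix.sub_mulVec, Matrix.smul_mulVec,
        Matrix.one_mulVec]
      abel
    have := hgr.2 hmem
    simp only [Pi.zero_apply]
    linarith
  obtain ⟨y, hy⟩ := Module.End.HasEigenvalue.exists_hasEigenvector hgr.1
  have hy1 : A.mulVec y = r • y := by
    have := hy.apply_eq_smul
    rwa [Matrix.toLin'_apply] at this
  have hA0 : ∀ v w, 0 ≤ A v w := by
    intro v w
    rw [hA, SimpleGraph.adjMatrix_apply]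
    split_ifs <;> norm_num
  set z : V → ℝ := fun v => |y v| with hz
  -- Taking absolute values cannot lower the quadratic form, so `z` lies in the kernel of the
  -- positive semidefinite `r • 1 - A`. Connectedness is not needed.
  have hquad : z ⬝ᵥ (A.mulVec z) ≥ r * (z ⬝ᵥ z) := by
    have h1 : y ⬝ᵥ (A.mulVec y) = r * (z ⬝ᵥ z) := by
      rw [hy1, dotProduct_smul, smul_eq_mul]
      congr 1
      simp [dotProduct, hz]
    rw [← h1]
    simp only [dotProduct, Matrix.mulVec, Finset.mul_sum]
    refine Finset.sum_le_sum fun v _ => Finset.sum_le_sum fun w _ => ?_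
    calc y v * (A v w * y w) ≤ |y v * (A v w * y w)| := le_abs_self _
      _ = z v * (A v w * z w) := by
        rw [abs_mul, abs_mul, abs_of_nonneg (hA0 v w)]
  have hz0 : A.mulVec z = r • z := by
    have h := (hpsd.dotProduct_mulVec_zero_iff z).1 (by
      refine le_antisymm ?_ (hpsd.dotProduct_mulVec_nonneg z)
      simp only [star_trivial, Matrix.sub_mulVec, Matrix.smul_mulVec, Matrix.one_mulVec,
        dotProduct_sub, dotProduct_smul, smul_eq_mul]
      linarith)
    rw [Matrix.sub_mulVec, Matrix.smul_mulVec, Matrix.one_mulVec, sub_eq_zero] at h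
    exact h.symm
  obtain ⟨u, hu⟩ := Finite.exists_max z
  have hupos : 0 < z u := by
    obtain ⟨v, hv⟩ := Function.ne_iff.1 hy.2
    exact lt_of_lt_of_le (abs_pos.2 hv) (hu v)
  refine ⟨fun v => z v / z u, u, fun v => div_nonneg (abs_nonneg _) hupos.le,
    fun v => (div_le_one hupos).2 (hu v), div_self hupos.ne', fun v => ?_⟩
  have := congrFun hz0 v
  simp only [Matrix.mulVec, dotProduct, Pi.smul_apply, smul_eq_mul] at this
  simp only [mul_div_assoc']
  rw [← Finset.sum_div, this]

theorem not_free_theta223 {V : Type*} (G : SimpleGraph V) {p q b e z a : V}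
    (hnd : [p, q, b, e, z, a].Nodup)
    (hpb : G.Adj p b) (hbq : G.Adj b q) (hpe : G.Adj p e) (heq : G.Adj e q)
    (hpz : G.Adj p z) (hza : G.Adj z a) (haq : G.Adj a q) : ¬ theta223.Free G := by
  refine not_not.2 ⟨⟨⟨![p, q, b, e, z, a], ?_⟩, ?_⟩⟩
  · intro i j hij
    simp only [theta223, SimpleGraph.fromEdgeSet_adj, Set.mem_insert_iff, Set.mem_singleton_iff,
      Sym2.eq_iff] at hij
    rcases hij with ⟨h, -⟩
    rcases h with h | h | h | h | h | h | h <;> rcases h with ⟨rfl, rfl⟩ | ⟨rfl, rfl⟩ <;>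
      first | assumption | exact SimpleGraph.Adj.symm ‹_›
  · simp only [List.nodup_cons, List.mem_cons, not_or] at hnd
    intro i j hij
    fin_cases i <;> fin_cases j <;> simp_all

/-! ### Counting edges and weights around a vertex `u` -/

section Counting

variable {V : Type*} (G : SimpleGraph V) [DecidableRel G.Adj]

/-- The number of neighbours of `v` in `S`. -/
def degIn (S : Finset V) (v : V) : ℕ := (S.filter (G.Adj v)).card

theorem sum_adjMatrix_eq_degIn (S : Finset V) (v : V) :
    ∑ w ∈ S, G.adjMatrix ℝ v w = degIn G S v := by
  simp [degIn, SimpleGraph.adjMatrix_apply]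

theorem adjMatrix_symm (v w : V) : G.adjMatrix ℝ v w = G.adjMatrix ℝ w v := by
  simp [SimpleGraph.adjMatrix_apply, G.adj_comm]

theorem adjMatrix_nonneg (v w : V) : 0 ≤ G.adjMatrix ℝ v w := by
  rw [SimpleGraph.adjMatrix_apply]
  split_ifs <;> norm_num

theorem degIn_mono {S T : Finset V} (h : S ⊆ T) (v : V) : degIn G S v ≤ degIn G T v :=
  Finset.card_le_card (Finset.filter_subset_filter _ h)

theorem degIn_pos {S : Finset V} {v w : V} (hw : w ∈ S) (h : G.Adj v w) : 1 ≤ degIn G S v :=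
  Finset.card_pos.2 ⟨w, Finset.mem_filter.2 ⟨hw, h⟩⟩

theorem exists_adj_of_degIn_pos {S : Finset V} {v : V} (h : 1 ≤ degIn G S v) :
    ∃ w ∈ S, G.Adj v w := by
  obtain ⟨w, hw⟩ := Finset.card_pos.1 h
  exact ⟨w, (Finset.mem_filter.1 hw).1, (Finset.mem_filter.1 hw).2⟩

theorem sum_sum_adjMatrix_swap (S T : Finset V) (x : V → ℝ) :
    ∑ v ∈ S, ∑ w ∈ T, G.adjMatrix ℝ v w * x w = ∑ w ∈ T, (degIn G S w : ℝ) * x w := by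
  rw [Finset.sum_comm]
  refine Finset.sum_congr rfl fun w _ => ?_
  rw [← Finset.sum_mul, ← sum_adjMatrix_eq_degIn]
  simp only [adjMatrix_symm G w]

variable [Fintype V] [DecidableEq V]

/-- The vertices outside the closed neighbourhood of `u`. -/
def farVertices (u : V) : Finset V := (insert u (G.neighborFinset u))ᶜ

theorem mem_farVertices {u w : V} : w ∈ farVertices G u ↔ w ≠ u ∧ ¬ G.Adj u w := by
  simp [farVertices]

theorem sum_univ_eq_add_sum_neighborFinset_add_sum_farVertices (u : V) (f : V → ℝ) :
    ∑ v, f v = f u + ∑ v ∈ G.neighborFinset u, f v + ∑ v ∈ farVertices G u, f v := by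
  rw [← Finset.sum_insert (by simp), farVertices, Finset.sum_add_sum_compl]

theorem two_mul_card_edgeFinset_eq (u : V) :
    (2 * G.edgeFinset.card : ℝ) = 2 * (G.neighborFinset u).card
      + ∑ v ∈ G.neighborFinset u, (degIn G (G.neighborFinset u) v : ℝ)
      + 2 * ∑ w ∈ farVertices G u, (degIn G (G.neighborFinset u) w : ℝ)
      + ∑ w ∈ farVertices G u, (degIn G (farVertices G u) w : ℝ) := by
  have h : (2 * G.edgeFinset.card : ℝ) = ∑ v, ∑ w, G.adjMatrix ℝ v w := by
    have := G.sum_degrees_eq_twice_card_edges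
    have h2 := congrArg (Nat.cast : ℕ → ℝ) this
    push_cast at h2
    rw [← h2]
    refine Finset.sum_congr rfl fun v _ => ?_
    rw [sum_adjMatrix_eq_degIn, degIn, ← SimpleGraph.card_neighborFinset_eq_degree,
      SimpleGraph.neighborFinset_eq_filter]
  have hs : ∀ v, ∑ w, G.adjMatrix ℝ v w = G.adjMatrix ℝ v u
      + degIn G (G.neighborFinset u) v + degIn G (farVertices G u) v := by
    intro v
    rw [sum_univ_eq_add_sum_neighborFinset_add_sum_farVertices G u, sum_adjMatrix_eq_degIn,
      sum_adjMatrix_eq_degIn]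
  have hsw : ∑ v ∈ G.neighborFinset u, (degIn G (farVertices G u) v : ℝ)
      = ∑ w ∈ farVertices G u, (degIn G (G.neighborFinset u) w : ℝ) := by
    have := sum_sum_adjMatrix_swap G (G.neighborFinset u) (farVertices G u) 1
    simpa [← sum_adjMatrix_eq_degIn] using this
  have hu1 : degIn G (G.neighborFinset u) u = (G.neighborFinset u).card := by
    rw [degIn, Finset.filter_true_of_mem]
    intro v hv
    simpa using hv
  have hu2 : degIn G (farVertices G u) u = 0 := by
    rw [degIn, Finset.card_eq_zero, Finset.filter_eq_empty_iff]
    intro v hv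
    exact ((mem_farVertices G).1 hv).2
  have hU : ∑ v ∈ G.neighborFinset u, G.adjMatrix ℝ v u = (G.neighborFinset u).card := by
    rw [Finset.sum_congr rfl (g := fun _ => (1 : ℝ)), Finset.sum_const, nsmul_eq_mul, mul_one]
    intro v hv
    simpa [G.adj_comm] using hv
  have hW : ∑ v ∈ farVertices G u, G.adjMatrix ℝ v u = 0 := by
    refine Finset.sum_eq_zero fun v hv => ?_
    simpa [G.adj_comm] using ((mem_farVertices G).1 hv).2
  rw [h]
  simp only [hs]
  rw [sum_univ_eq_add_sum_neighborFinset_add_sum_farVertices G u]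
  simp only [Finset.sum_add_distrib, hsw, hU, hW, hu1, hu2]
  simp
  ring

theorem sq_sub_self_eq_of_eigenvector {x : V → ℝ} {u : V} {r : ℝ} (hu : x u = 1)
    (hx : ∀ v, ∑ w, G.adjMatrix ℝ v w * x w = r * x v) :
    r ^ 2 - r = G.edgeFinset.card
      + ∑ v ∈ G.neighborFinset u, (((degIn G (G.neighborFinset u) v : ℝ) - 1) * x v
        - degIn G (G.neighborFinset u) v / 2)
      - ∑ w ∈ farVertices G u, (degIn G (G.neighborFinset u) w * (1 - x w)
        + degIn G (farVertices G u) w / 2) := by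
  have hr : ∑ v ∈ G.neighborFinset u, x v = r := by
    have := hx u
    rw [hu, mul_one] at this
    rw [← this, SimpleGraph.neighborFinset_eq_filter, Finset.sum_filter]
    simp [SimpleGraph.adjMatrix_apply]
  have h2 : ∑ v ∈ G.neighborFinset u, r * x v = (G.neighborFinset u).card
      + ∑ v ∈ G.neighborFinset u, (degIn G (G.neighborFinset u) v : ℝ) * x v
      + ∑ w ∈ farVertices G u, (degIn G (G.neighborFinset u) w : ℝ) * x w := by
    rw [← sum_sum_adjMatrix_swap, ← sum_sum_adjMatrix_swap, Finset.card_eq_sum_ones]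
    push_cast
    rw [← Finset.sum_add_distrib, ← Finset.sum_add_distrib]
    refine Finset.sum_congr rfl fun v hv => ?_
    rw [← hx, sum_univ_eq_add_sum_neighborFinset_add_sum_farVertices G u, hu]
    rw [SimpleGraph.mem_neighborFinset] at hv
    simp [SimpleGraph.adjMatrix_apply, hv.symm]
  rw [← Finset.mul_sum, hr] at h2
  have h3 := two_mul_card_edgeFinset_eq G u
  simp only [Finset.sum_sub_distrib, Finset.sum_add_distrib, sub_mul, mul_sub, one_mul, mul_one,
    ← Finset.sum_div, hr]
  linarith

end Counting

/-! ### Structure of θ-free neighbourhoods and the cost estimate -/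

section ThetaFree

variable {V : Type*} [Fintype V] [DecidableEq V] {G : SimpleGraph V} [DecidableRel G.Adj]

omit [Fintype V] in
theorem exists_pair_of_four_le_degIn {S : Finset V} {v : V} (h : 4 ≤ degIn G S v) (s t : V) :
    ∃ b ∈ S, ∃ e ∈ S, b ≠ e ∧ G.Adj v b ∧ G.Adj v e ∧ b ≠ s ∧ b ≠ t ∧ e ≠ s ∧ e ≠ t := by
  have hc : 1 < ((S.filter (G.Adj v)) \ {s, t}).card := by
    have h1 := Finset.le_card_sdiff ({s, t} : Finset V) (S.filter (G.Adj v))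
    have h2 := Finset.card_le_two (a := s) (b := t)
    unfold degIn at h
    omega
  obtain ⟨b, hb, e, he, hbe⟩ := Finset.one_lt_card.1 hc
  simp only [Finset.mem_sdiff, Finset.mem_filter, Finset.mem_insert, Finset.mem_singleton,
    not_or] at hb he
  exact ⟨b, hb.1.1, e, he.1.1, hbe, hb.1.2, he.1.2, hb.2.1, hb.2.2, he.2.1, he.2.2⟩

/-- Otherwise `u - z - a - v` and two paths `u - b - v`, `u - e - v` form a θ; four common
neighbours leave room for `b`, `e` to avoid `a`, `z`. Here `v` may be a neighbour of `u` or a far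
vertex, and both cases are used. -/
theorem not_adj_of_four_le_degIn (hfree : theta223.Free G) {u v a z : V} (hvu : v ≠ u)
    (h : 4 ≤ degIn G (G.neighborFinset u) v) (ha : G.Adj u a) (hva : G.Adj v a)
    (hz : G.Adj u z) (hzv : z ≠ v) : ¬ G.Adj a z := by
  intro haz
  obtain ⟨b, hb, e, he, hbe, hvb, hve, hba, hbz, hea, hez⟩ := exists_pair_of_four_le_degIn h a z
  rw [SimpleGraph.mem_neighborFinset] at hb he
  refine not_free_theta223 G (p := u) (q := v) (b := b) (e := e) (z := z) (a := a) ?_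
    hb hvb.symm he hve.symm hz haz.symm hva.symm hfree
  simp [hvu.symm, hb.ne, he.ne, hz.ne, ha.ne, hvb.ne, hve.ne, hzv.symm, hva.ne, hbe, hba, hbz,
    hea, hez, haz.ne.symm]

theorem degIn_neighborFinset_eq_one (hfree : theta223.Free G) {u v a : V} (hv : G.Adj u v)
    (h : 4 ≤ degIn G (G.neighborFinset u) v) (ha : G.Adj u a) (hva : G.Adj v a) :
    degIn G (G.neighborFinset u) a = 1 := by
  rw [degIn, Finset.card_eq_one]
  refine ⟨v, Finset.eq_singleton_iff_unique_mem.2 ⟨by simp [hv, hva.symm], fun z hz => ?_⟩⟩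
  rw [Finset.mem_filter, SimpleGraph.mem_neighborFinset] at hz
  by_contra hzv
  exact not_adj_of_four_le_degIn hfree hv.ne.symm h ha hva hz.1 hzv hz.2

theorem degIn_neighborFinset_le_three (hfree : theta223.Free G) {u w b : V}
    (hw : w ∈ farVertices G u) (hb : G.Adj u b) (hwb : G.Adj w b)
    (h : 1 ≤ degIn G (G.neighborFinset u) b) : degIn G (G.neighborFinset u) w ≤ 3 := by
  by_contra! h4
  obtain ⟨c, hc, hbc⟩ := exists_adj_of_degIn_pos G h
  rw [SimpleGraph.mem_neighborFinset] at hc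
  rw [mem_farVertices] at hw
  exact not_adj_of_four_le_degIn hfree hw.1 h4 hb hwb hc (fun e => hw.2 (e ▸ hc)) hbc

/-- The neighbours of `u` that have one to three neighbours inside `N(u)`, none of which has
more than three. -/
def smallPart (G : SimpleGraph V) [DecidableRel G.Adj] (u : V) : Finset V :=
  (G.neighborFinset u).filter fun v => 1 ≤ degIn G (G.neighborFinset u) v ∧
    degIn G (G.neighborFinset u) v ≤ 3 ∧
    ∀ c ∈ G.neighborFinset u, G.Adj v c → degIn G (G.neighborFinset u) c ≤ 3

theorem smallPart_subset (u : V) : smallPart G u ⊆ G.neighborFinset u :=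
  Finset.filter_subset _ _

/-- So `smallPart` is a union of components of `G[N(u)]`: a neighbour of `a` with degree at least 4
would make `a` a leaf, hence would be `v` itself. -/
theorem mem_smallPart_of_adj (hfree : theta223.Free G) {u v a : V} (hv : v ∈ smallPart G u)
    (ha : G.Adj u a) (hva : G.Adj v a) : a ∈ smallPart G u := by
  simp only [smallPart, Finset.mem_filter, SimpleGraph.mem_neighborFinset] at hv ⊢
  refine ⟨ha, degIn_pos G (by simpa using hv.1) hva.symm, hv.2.2.2 a ha hva, fun c hc hac => ?_⟩
  by_contra! hc4
  have h1 := degIn_neighborFinset_eq_one hfree hc hc4 ha hac.symm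
  rw [degIn, Finset.card_eq_one] at h1
  obtain ⟨y, hy⟩ := h1
  have hcy : c = y := by
    rw [← Finset.mem_singleton, ← hy]
    simp [hc, hac]
  have hvy : v = y := by
    rw [← Finset.mem_singleton, ← hy]
    simp [hv.1, hva.symm]
  have := hv.2.2.1
  rw [hvy, ← hcy] at this
  omega

/-- Sum the eigenvalue equations over `smallPart`: `u` contributes 1 to each, and edges inside
`N(u)` do not leave `smallPart`. -/
theorem sum_smallPart_le (hfree : theta223.Free G) {x : V → ℝ} {u : V} {r : ℝ}
    (hx0 : ∀ v, 0 ≤ x v) (hu : x u = 1)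
    (hx : ∀ v, ∑ w, G.adjMatrix ℝ v w * x w = r * x v) :
    ∑ v ∈ smallPart G u, ((r - degIn G (G.neighborFinset u) v) * x v - 1)
      ≤ ∑ w ∈ farVertices G u, (degIn G (smallPart G u) w : ℝ) * x w := by
  have h1 : ∑ v ∈ smallPart G u, ∑ a ∈ G.neighborFinset u, G.adjMatrix ℝ v a * x a
      ≤ ∑ v ∈ smallPart G u, (degIn G (G.neighborFinset u) v : ℝ) * x v := by
    have : ∑ v ∈ smallPart G u, ∑ a ∈ G.neighborFinset u, G.adjMatrix ℝ v a * x a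
        = ∑ v ∈ smallPart G u, ∑ a ∈ smallPart G u, G.adjMatrix ℝ v a * x a := by
      refine Finset.sum_congr rfl fun v hv => (Finset.sum_subset (smallPart_subset u) ?_).symm
      intro a ha ha'
      have : ¬ G.Adj v a := fun h =>
        ha' (mem_smallPart_of_adj hfree hv (by simpa using ha) h)
      simp [SimpleGraph.adjMatrix_apply, this]
    rw [this, sum_sum_adjMatrix_swap]
    refine Finset.sum_le_sum fun v _ => mul_le_mul_of_nonneg_right ?_ (hx0 v)
    exact_mod_cast degIn_mono G (smallPart_subset u) v
  rw [← sum_sum_adjMatrix_swap]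
  have h2 : ∑ v ∈ smallPart G u, r * x v = ∑ v ∈ smallPart G u, (1 : ℝ)
      + ∑ v ∈ smallPart G u, ∑ a ∈ G.neighborFinset u, G.adjMatrix ℝ v a * x a
      + ∑ v ∈ smallPart G u, ∑ w ∈ farVertices G u, G.adjMatrix ℝ v w * x w := by
    rw [← Finset.sum_add_distrib, ← Finset.sum_add_distrib]
    refine Finset.sum_congr rfl fun v hv => ?_
    rw [← hx, sum_univ_eq_add_sum_neighborFinset_add_sum_farVertices G u, hu]
    have hv := smallPart_subset u hv
    rw [SimpleGraph.mem_neighborFinset] at hv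
    simp [SimpleGraph.adjMatrix_apply, hv.symm]
  simp only [sub_mul, Finset.sum_sub_distrib]
  linarith

/-- A way to distribute the edges inside `N(u)` over the vertices: a vertex with at least four
neighbours in `N(u)` takes all its edges, the others share their edges evenly. -/
noncomputable def edgeShare (G : SimpleGraph V) [DecidableRel G.Adj] (u v : V) : ℝ :=
  ∑ a ∈ G.neighborFinset u, if G.Adj v a then
    (if 4 ≤ degIn G (G.neighborFinset u) v then 1
      else if 4 ≤ degIn G (G.neighborFinset u) a then 0 else 1 / 2) else 0

theorem sum_edgeShare (hfree : theta223.Free G) (u : V) :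
    ∑ v ∈ G.neighborFinset u, edgeShare G u v
      = ∑ v ∈ G.neighborFinset u, (degIn G (G.neighborFinset u) v : ℝ) / 2 := by
  have hsw : ∑ v ∈ G.neighborFinset u, edgeShare G u v
      = ∑ v ∈ G.neighborFinset u, ∑ a ∈ G.neighborFinset u, if G.Adj v a then
    (if 4 ≤ degIn G (G.neighborFinset u) a then (1 : ℝ)
      else if 4 ≤ degIn G (G.neighborFinset u) v then 0 else 1 / 2) else 0 := by
    rw [Finset.sum_comm]
    simp only [edgeShare, G.adj_comm]
  have h2 : ∑ v ∈ G.neighborFinset u, edgeShare G u v + ∑ v ∈ G.neighborFinset u, edgeShare G u v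
      = ∑ v ∈ G.neighborFinset u, (degIn G (G.neighborFinset u) v : ℝ) := by
    nth_rw 2 [hsw]
    simp only [edgeShare, ← Finset.sum_add_distrib, ← sum_adjMatrix_eq_degIn]
    refine Finset.sum_congr rfl fun v hv => Finset.sum_congr rfl fun a ha => ?_
    rw [SimpleGraph.adjMatrix_apply]
    rw [SimpleGraph.mem_neighborFinset] at hv ha
    by_cases hva : G.Adj v a
    -- Two centres are never adjacent, so the two shares of each edge add up to 1.
    · have : ¬ (4 ≤ degIn G (G.neighborFinset u) v ∧ 4 ≤ degIn G (G.neighborFinset u) a) := by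
        rintro ⟨h1, h2⟩
        have := degIn_neighborFinset_eq_one hfree hv h1 ha hva
        omega
      simp only [hva, if_true]
      split_ifs <;> first | (exfalso; tauto) | norm_num
    · simp [hva]
  rw [← Finset.sum_div]
  linarith

omit [DecidableEq V] in
theorem edgeShare_of_four_le {u v : V} (h : 4 ≤ degIn G (G.neighborFinset u) v) :
    edgeShare G u v = degIn G (G.neighborFinset u) v := by
  simp [edgeShare, h, ← sum_adjMatrix_eq_degIn, SimpleGraph.adjMatrix_apply]

omit [DecidableEq V] in
theorem edgeShare_nonneg (u v : V) : 0 ≤ edgeShare G u v := by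
  refine Finset.sum_nonneg fun a _ => ?_
  split_ifs <;> norm_num

theorem edgeShare_of_mem_smallPart {u v : V} (h : v ∈ smallPart G u) :
    edgeShare G u v = (degIn G (G.neighborFinset u) v : ℝ) / 2 := by
  simp only [smallPart, Finset.mem_filter] at h
  rw [edgeShare, ← sum_adjMatrix_eq_degIn, Finset.sum_div]
  refine Finset.sum_congr rfl fun a ha => ?_
  have h1 : ¬ 4 ≤ degIn G (G.neighborFinset u) v := by omega
  by_cases hva : G.Adj v a
  · have := h.2.2.2 a ha hva
    have h2 : ¬ 4 ≤ degIn G (G.neighborFinset u) a := by omega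
    simp [hva, h1, h2, SimpleGraph.adjMatrix_apply]
  · simp [hva, SimpleGraph.adjMatrix_apply]

/-- The cost of a neighbour `v` of `u`, for a nonnegative eigenvector `x` with eigenvalue `r`. -/
noncomputable def vertexCost (G : SimpleGraph V) [DecidableRel G.Adj] (x : V → ℝ) (r : ℝ) (u v : V) : ℝ :=
  edgeShare G u v - ((degIn G (G.neighborFinset u) v : ℝ) - 1) * x v
    + if v ∈ smallPart G u then 2 / 5 * ((r - degIn G (G.neighborFinset u) v) * x v - 1) else 0

/-- The cost of a vertex `w` at distance at least two from `u`. -/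
noncomputable def farCost (G : SimpleGraph V) [DecidableRel G.Adj] (x : V → ℝ) (u w : V) : ℝ :=
  degIn G (G.neighborFinset u) w * (1 - x w) + (degIn G (farVertices G u) w : ℝ) / 2
    - 2 / 5 * (degIn G (smallPart G u) w * x w)

theorem sq_sub_self_le (hfree : theta223.Free G) {x : V → ℝ} {u : V} {r : ℝ}
    (hx0 : ∀ v, 0 ≤ x v) (hu : x u = 1)
    (hx : ∀ v, ∑ w, G.adjMatrix ℝ v w * x w = r * x v) :
    r ^ 2 - r ≤ G.edgeFinset.card - ∑ v ∈ G.neighborFinset u, vertexCost G x r u v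
      - ∑ w ∈ farVertices G u, farCost G x u w := by
  have h1 := sq_sub_self_eq_of_eigenvector G hu hx
  have h2 := sum_smallPart_le hfree hx0 hu hx
  have h3 := sum_edgeShare hfree u
  simp only [vertexCost, farCost, Finset.sum_add_distrib, Finset.sum_sub_distrib,
    ← Finset.mul_sum] at h1 ⊢
  rw [← Finset.sum_filter, Finset.filter_mem_eq_inter,
    Finset.inter_eq_right.2 (smallPart_subset u), ← Finset.mul_sum, Finset.sum_sub_distrib]
  rw [Finset.sum_sub_distrib] at h2
  linarith

theorem one_le_vertexCost_of_four_le {x : V → ℝ} {u v : V} {r : ℝ} (hx1 : x v ≤ 1)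
    (h : 4 ≤ degIn G (G.neighborFinset u) v) : 1 ≤ vertexCost G x r u v := by
  have hP : v ∉ smallPart G u := by
    simp only [smallPart, Finset.mem_filter]
    omega
  rw [vertexCost, edgeShare_of_four_le h, if_neg hP]
  have : (4 : ℝ) ≤ degIn G (G.neighborFinset u) v := by exact_mod_cast h
  nlinarith

/-- The weight 2/5 makes the coefficient of `x v` vanish in the worst case, degree 3 and `r = 8`,
leaving the constant 11/10. -/
theorem le_vertexCost_of_mem_smallPart {x : V → ℝ} {u v : V} {r : ℝ} (hr : 8 ≤ r)
    (hx0 : 0 ≤ x v) (hx1 : x v ≤ 1) (h : v ∈ smallPart G u) : x v ≤ vertexCost G x r u v := by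
  rw [vertexCost, edgeShare_of_mem_smallPart h, if_pos h]
  simp only [smallPart, Finset.mem_filter] at h
  have hrx : 8 * x v ≤ r * x v := mul_le_mul_of_nonneg_right hr hx0
  generalize degIn G (G.neighborFinset u) v = d at h ⊢
  obtain ⟨-, h1, h3, -⟩ := h
  interval_cases d <;> push_cast <;> nlinarith

theorem le_vertexCost_of_degIn_eq_zero {x : V → ℝ} {u v : V} {r : ℝ}
    (h : degIn G (G.neighborFinset u) v = 0) : x v ≤ vertexCost G x r u v := by
  have hP : v ∉ smallPart G u := by
    simp only [smallPart, Finset.mem_filter]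
    omega
  rw [vertexCost, if_neg hP, h]
  have := edgeShare_nonneg (G := G) u v
  push_cast
  linarith

theorem vertexCost_nonneg_of_adj (hfree : theta223.Free G) {x : V → ℝ} {u v c : V} {r : ℝ}
    (hv : G.Adj u v) (hc : G.Adj u c) (hvc : G.Adj v c)
    (h : 4 ≤ degIn G (G.neighborFinset u) c) : 0 ≤ vertexCost G x r u v := by
  have hP : v ∉ smallPart G u := by
    simp only [smallPart, Finset.mem_filter, not_and, not_forall]
    intro _ _ _
    exact ⟨c, by simpa using hc, hvc, by omega⟩
  rw [vertexCost, if_neg hP, degIn_neighborFinset_eq_one hfree hc h hv hvc.symm]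
  have := edgeShare_nonneg (G := G) u v
  push_cast
  linarith

theorem neighbor_cases {u v : V} (hv : G.Adj u v) :
    degIn G (G.neighborFinset u) v = 0 ∨ v ∈ smallPart G u ∨
      4 ≤ degIn G (G.neighborFinset u) v ∨
      ∃ c, G.Adj u c ∧ G.Adj v c ∧ 4 ≤ degIn G (G.neighborFinset u) c := by
  by_contra! h
  refine h.2.1 ?_
  simp only [smallPart, Finset.mem_filter, SimpleGraph.mem_neighborFinset]
  exact ⟨hv, by omega, by omega, fun c hc hvc => by have := h.2.2.2 c hc hvc; omega⟩

theorem mul_le_degIn_add_degIn {x : V → ℝ} {u w : V} {r : ℝ} (hx1 : ∀ v, x v ≤ 1)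
    (hx : ∀ v, ∑ w, G.adjMatrix ℝ v w * x w = r * x v) (hw : w ∈ farVertices G u) :
    r * x w ≤ degIn G (G.neighborFinset u) w + degIn G (farVertices G u) w := by
  rw [← hx, sum_univ_eq_add_sum_neighborFinset_add_sum_farVertices G u, ← sum_adjMatrix_eq_degIn,
    ← sum_adjMatrix_eq_degIn]
  have h0 : G.adjMatrix ℝ w u = 0 := by
    simpa [G.adj_comm] using ((mem_farVertices G).1 hw).2
  rw [h0, zero_mul, zero_add]
  gcongr <;> exact mul_le_of_le_one_right (adjMatrix_nonneg G _ _) (hx1 _)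

/-- With few neighbours in `N(u)`, the entry `x w` can be large only if `w` has many far neighbours,
and these pay 1/2 each. -/
theorem farCost_pos_of_le_three {x : V → ℝ} {u w : V} {r : ℝ} (hr : 8 ≤ r)
    (hx0 : ∀ v, 0 ≤ x v) (hx1 : ∀ v, x v ≤ 1)
    (hx : ∀ v, ∑ w, G.adjMatrix ℝ v w * x w = r * x v) (hw : w ∈ farVertices G u)
    (hiso : ∃ v, G.Adj w v) (h : degIn G (G.neighborFinset u) w ≤ 3) : 0 < farCost G x u w := by
  have h1 := mul_le_degIn_add_degIn hx1 hx hw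
  have h2 : 8 * x w ≤ r * x w := mul_le_mul_of_nonneg_right hr (hx0 w)
  have h3 : (degIn G (smallPart G u) w : ℝ) * x w ≤ degIn G (G.neighborFinset u) w * x w :=
    mul_le_mul_of_nonneg_right (by exact_mod_cast degIn_mono G (smallPart_subset u) w) (hx0 w)
  have h4 : 1 ≤ degIn G (G.neighborFinset u) w + degIn G (farVertices G u) w := by
    obtain ⟨v, hv⟩ := hiso
    by_cases huv : G.Adj u v
    · have := degIn_pos G (S := G.neighborFinset u) (by simpa using huv) hv
      omega
    · have hvu : v ≠ u := by
        rintro rfl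
        exact ((mem_farVertices G).1 hw).2 hv.symm
      have := degIn_pos G ((mem_farVertices G).2 ⟨hvu, huv⟩) hv
      omega
  have h4' : (1 : ℝ) ≤ degIn G (G.neighborFinset u) w + degIn G (farVertices G u) w := by
    exact_mod_cast h4
  have h5 : (0 : ℝ) ≤ degIn G (farVertices G u) w := Nat.cast_nonneg _
  have h6 := hx1 w
  rw [farCost]
  generalize degIn G (G.neighborFinset u) w = d at *
  interval_cases d <;> push_cast at * <;> linarith

theorem farCost_nonneg (hfree : theta223.Free G) {x : V → ℝ} {u w : V} {r : ℝ} (hr : 8 ≤ r)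
    (hx0 : ∀ v, 0 ≤ x v) (hx1 : ∀ v, x v ≤ 1)
    (hx : ∀ v, ∑ w, G.adjMatrix ℝ v w * x w = r * x v) (hw : w ∈ farVertices G u)
    (hiso : ∃ v, G.Adj w v) : 0 ≤ farCost G x u w := by
  by_cases h : degIn G (G.neighborFinset u) w ≤ 3
  · exact (farCost_pos_of_le_three hr hx0 hx1 hx hw hiso h).le
  -- With four neighbours in `N(u)`, none lies in `smallPart`, so the negative term disappears.
  · have h0 : degIn G (smallPart G u) w = 0 := by
      by_contra h0
      obtain ⟨b, hb, hwb⟩ := exists_adj_of_degIn_pos G (Nat.one_le_iff_ne_zero.2 h0)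
      simp only [smallPart, Finset.mem_filter, SimpleGraph.mem_neighborFinset] at hb
      exact h (degIn_neighborFinset_le_three hfree hw hb.1 hwb hb.2.1)
    rw [farCost, h0]
    have := mul_nonneg (Nat.cast_nonneg (α := ℝ) (degIn G (G.neighborFinset u) w))
      (sub_nonneg.2 (hx1 w))
    have : (0 : ℝ) ≤ degIn G (farVertices G u) w := Nat.cast_nonneg _
    push_cast
    linarith

/-- All vertices other than the adjacent vertices `u` and `c` are adjacent exactly to these. -/
def IsBookWithSpine (G : SimpleGraph V) (u c : V) : Prop :=
  G.Adj u c ∧ (∀ v, v ≠ u → v ≠ c → G.Adj u v ∧ G.Adj c v) ∧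
    ∀ v w, v ≠ u → v ≠ c → w ≠ u → w ≠ c → ¬ G.Adj v w

theorem sq_sub_self_le_card_sub_one (hfree : theta223.Free G) (hiso : ∀ v, ∃ w, G.Adj v w)
    {x : V → ℝ} {u : V} {r : ℝ} (hr : 8 ≤ r) (hx0 : ∀ v, 0 ≤ x v) (hx1 : ∀ v, x v ≤ 1)
    (hu : x u = 1) (hx : ∀ v, ∑ w, G.adjMatrix ℝ v w * x w = r * x v) :
    r ^ 2 - r ≤ G.edgeFinset.card - 1 ∧
      (r ^ 2 - r = G.edgeFinset.card - 1 → ∃ c, IsBookWithSpine G u c) := by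
  have hmain := sq_sub_self_le hfree hx0 hu hx
  have hfar : ∀ w ∈ farVertices G u, 0 ≤ farCost G x u w := fun w hw =>
    farCost_nonneg hfree hr hx0 hx1 hx hw (hiso w)
  have hfs := Finset.sum_nonneg hfar
  have hsum : ∑ v ∈ G.neighborFinset u, x v = r := by
    have := hx u
    rw [hu, mul_one] at this
    rw [← this, SimpleGraph.neighborFinset_eq_filter, Finset.sum_filter]
    simp [SimpleGraph.adjMatrix_apply]
  by_cases hcen : ∃ c, G.Adj u c ∧ 4 ≤ degIn G (G.neighborFinset u) c
  · obtain ⟨c, huc, hc⟩ := hcen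
    have hnn : ∀ v ∈ G.neighborFinset u, 0 ≤ vertexCost G x r u v := by
      intro v hv
      rw [SimpleGraph.mem_neighborFinset] at hv
      rcases neighbor_cases hv with h | h | h | ⟨d, hd, hvd, h⟩
      · exact (hx0 v).trans (le_vertexCost_of_degIn_eq_zero h)
      · exact (hx0 v).trans (le_vertexCost_of_mem_smallPart hr (hx0 v) (hx1 v) h)
      · exact zero_le_one.trans (one_le_vertexCost_of_four_le (hx1 v) h)
      · exact vertexCost_nonneg_of_adj hfree hv hd hvd h
    have hcU : c ∈ G.neighborFinset u := by simpa using huc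
    have hc1 : 1 ≤ vertexCost G x r u c := one_le_vertexCost_of_four_le (hx1 c) hc
    have hsplit := Finset.add_sum_erase _ (vertexCost G x r u) hcU
    have hnn' : ∀ v ∈ (G.neighborFinset u).erase c, 0 ≤ vertexCost G x r u v := fun v hv =>
      hnn v (Finset.mem_of_mem_erase hv)
    have hes := Finset.sum_nonneg hnn'
    refine ⟨by linarith, fun heq => ⟨c, huc, ?_⟩⟩
    have he0 := (Finset.sum_eq_zero_iff_of_nonneg hnn').1 (by linarith)
    have hf0 := (Finset.sum_eq_zero_iff_of_nonneg hfar).1 (by linarith)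
    have hxpos : ∀ v, G.Adj u v → 0 < x v := by
      intro v hv
      have h1 : 1 ≤ r * x v := by
        rw [← hx, sum_univ_eq_add_sum_neighborFinset_add_sum_farVertices G u, hu]
        have ha : G.adjMatrix ℝ v u = 1 := by simpa [G.adj_comm] using hv
        have h2 : ∀ S : Finset V, 0 ≤ ∑ w ∈ S, G.adjMatrix ℝ v w * x w := fun S =>
          Finset.sum_nonneg fun w _ => mul_nonneg (adjMatrix_nonneg G _ _) (hx0 w)
        linarith [h2 (G.neighborFinset u), h2 (farVertices G u)]
      by_contra! h
      nlinarith
    have hleaf : ∀ v, G.Adj u v → v ≠ c → G.Adj v c := by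
      intro v hv hvc
      have hv0 := he0 v (Finset.mem_erase.2 ⟨hvc, by simpa using hv⟩)
      have hvp := hxpos v hv
      rcases neighbor_cases hv with h | h | h | ⟨d, hd, hvd, h⟩
      · linarith [le_vertexCost_of_degIn_eq_zero (x := x) (r := r) h]
      · linarith [le_vertexCost_of_mem_smallPart hr (hx0 v) (hx1 v) h]
      · linarith [one_le_vertexCost_of_four_le (x := x) (r := r) (hx1 v) h]
      · by_cases hdc : d = c
        · exact hdc ▸ hvd
        · have := he0 d (Finset.mem_erase.2 ⟨hdc, by simpa using hd⟩)
          linarith [one_le_vertexCost_of_four_le (x := x) (r := r) (hx1 d) h]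
    -- Every vertex of `N(u)` now has a neighbour in `N(u)`, so a far vertex has at most three
    -- neighbours there and a strictly positive cost.
    have hnofar : ∀ w, w ∉ farVertices G u := by
      intro w hw
      have hle : degIn G (G.neighborFinset u) w ≤ 3 := by
        by_cases h0 : 1 ≤ degIn G (G.neighborFinset u) w
        · obtain ⟨b, hb, hwb⟩ := exists_adj_of_degIn_pos G h0
          rw [SimpleGraph.mem_neighborFinset] at hb
          refine degIn_neighborFinset_le_three hfree hw hb hwb ?_
          by_cases hbc : b = c
          · rw [hbc]
            omega
          · exact degIn_pos G hcU (hleaf b hb hbc)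
        · omega
      exact (farCost_pos_of_le_three hr hx0 hx1 hx hw (hiso w) hle).ne' (hf0 w hw)
    have hadj : ∀ v, v ≠ u → G.Adj u v := by
      intro v hv
      have := hnofar v
      rw [mem_farVertices] at this
      tauto
    exact ⟨fun v hvu hvc => ⟨hadj v hvu, (hleaf v (hadj v hvu) hvc).symm⟩,
      fun v w hvu hvc hwu hwc => not_adj_of_four_le_degIn hfree huc.ne.symm hc (hadj v hvu)
        (hleaf v (hadj v hvu) hvc).symm (hadj w hwu) hwc⟩
  -- Without a centre the total cost is at least `r ≥ 8`, which also excludes equality.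
  · have hle : ∑ v ∈ G.neighborFinset u, x v ≤ ∑ v ∈ G.neighborFinset u, vertexCost G x r u v := by
      refine Finset.sum_le_sum fun v hv => ?_
      rw [SimpleGraph.mem_neighborFinset] at hv
      rcases neighbor_cases hv with h | h | h | ⟨d, hd, hvd, h⟩
      · exact le_vertexCost_of_degIn_eq_zero h
      · exact le_vertexCost_of_mem_smallPart hr (hx0 v) (hx1 v) h
      · exact absurd ⟨v, hv, h⟩ hcen
      · exact absurd ⟨d, hd, h⟩ hcen
    exact ⟨by linarith, fun heq => by linarith⟩

end ThetaFree

/-! ### Book graphs: edge count, eigenvalue, recognition -/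

section Book

theorem bookGraph_adj_inl_inl {k : ℕ} (i j : Fin 2) :
    (bookGraph k).Adj (Sum.inl i) (Sum.inl j) ↔ i ≠ j := by
  simp [bookGraph, graphJoin]

theorem bookGraph_adj_inl_inr {k : ℕ} (i : Fin 2) (j : Fin k) :
    (bookGraph k).Adj (Sum.inl i) (Sum.inr j) := by
  simp [bookGraph, graphJoin]

theorem bookGraph_adj_inr_inl {k : ℕ} (i : Fin 2) (j : Fin k) :
    (bookGraph k).Adj (Sum.inr j) (Sum.inl i) :=
  (bookGraph_adj_inl_inr i j).symm

theorem not_bookGraph_adj_inr_inr {k : ℕ} (i j : Fin k) :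
    ¬ (bookGraph k).Adj (Sum.inr i) (Sum.inr j) := by
  simp [bookGraph, graphJoin]

variable {V : Type*} [Fintype V] [DecidableEq V] {G : SimpleGraph V} [DecidableRel G.Adj]

omit [DecidableEq V] in
theorem card_edgeFinset_of_iso_bookGraph {k : ℕ} (φ : G ≃g bookGraph k) :
    G.edgeFinset.card = 2 * k + 1 := by
  classical
  rw [φ.card_edgeFinset_eq]
  have h := (bookGraph k).sum_degrees_eq_twice_card_edges
  have hdeg : ∀ v, (bookGraph k).degree v = ∑ w, if (bookGraph k).Adj v w then 1 else 0 := by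
    intro v
    rw [← SimpleGraph.card_neighborFinset_eq_degree, SimpleGraph.neighborFinset_eq_filter,
      Finset.card_filter]
  simp [-Finset.sum_boole, hdeg, Fintype.sum_sum_type, bookGraph_adj_inl_inl, bookGraph_adj_inl_inr,
    bookGraph_adj_inr_inl, not_bookGraph_adj_inr_inr] at h
  omega

theorem le_graphSpectralRadius_of_iso_bookGraph {k : ℕ} (φ : G ≃g bookGraph k) {r : ℝ}
    (hr0 : r ≠ 0) (hr : r ^ 2 - r = 2 * k) : r ≤ graphSpectralRadius G := by
  classical
  have : Nonempty V := ⟨φ.symm (Sum.inl 0)⟩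
  refine (isGreatest_graphSpectralRadius G).2 ?_
  -- Eigenvector constant on spine and pages: the spine equation is `r + 2k = r²`, the page equation
  -- `2r = r * 2`.
  set f : Fin 2 ⊕ Fin k → ℝ := Sum.elim (fun _ => r) (fun _ => 2) with hf
  have hbook : ∀ i, ∑ j, (if (bookGraph k).Adj i j then f j else 0) = r * f i := by
    rintro (i | i)
    · rw [Fintype.sum_sum_type, Fin.sum_univ_two]
      fin_cases i <;> simp [bookGraph_adj_inl_inl, bookGraph_adj_inl_inr, hf] <;> linarith
    · rw [Fintype.sum_sum_type, Fin.sum_univ_two]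
      simp [bookGraph_adj_inr_inl, not_bookGraph_adj_inr_inr, hf]
      ring
  refine Module.End.hasEigenvalue_of_hasEigenvector (x := fun v => f (φ v))
    ⟨Module.End.mem_eigenspace_iff.2 ?_, ?_⟩
  · ext v
    rw [Matrix.toLin'_apply, Pi.smul_apply, smul_eq_mul, ← hbook, ← φ.toEquiv.sum_comp]
    simp only [Matrix.mulVec, dotProduct, SimpleGraph.adjMatrix_apply, ite_mul, one_mul, zero_mul]
    refine Finset.sum_congr rfl fun w _ => ?_
    have : (bookGraph k).Adj (φ v) (φ.toEquiv w) ↔ G.Adj v w := φ.map_adj_iff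
    simp only [this]
    rfl
  · intro h
    have := congrFun h (φ.symm (Sum.inl 0))
    simp [hf] at this
    exact hr0 this

omit [DecidableRel G.Adj] in
theorem IsBookWithSpine.exists_iso {u c : V} (h : IsBookWithSpine G u c) :
    ∃ k : ℕ, Nonempty (G ≃g bookGraph k) := by
  obtain ⟨huc, h1, h2⟩ := h
  have hne := huc.ne
  let e := Fintype.equivFin {v : V // v ≠ u ∧ v ≠ c}
  refine ⟨Fintype.card {v : V // v ≠ u ∧ v ≠ c}, ⟨RelIso.symm ⟨Equiv.ofBijective
    (Sum.elim ![u, c] fun j => (e.symm j : V)) ⟨?_, ?_⟩, ?_⟩⟩⟩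
  · rintro (i | i) (j | j) hij
    · fin_cases i <;> fin_cases j <;> simp_all
    · have := (e.symm j).2
      fin_cases i <;> simp_all
    · have := (e.symm i).2
      fin_cases j <;> simp_all
    · exact congrArg Sum.inr (e.symm.injective (Subtype.ext hij))
  · intro v
    by_cases hvu : v = u
    · exact ⟨Sum.inl 0, by simp [hvu]⟩
    · by_cases hvc : v = c
      · exact ⟨Sum.inl 1, by simp [hvc]⟩
      · exact ⟨Sum.inr (e ⟨v, hvu, hvc⟩), by simp⟩
  · intro a b
    change G.Adj (Sum.elim ![u, c] (fun j => (e.symm j : V)) a)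
      (Sum.elim ![u, c] (fun j => (e.symm j : V)) b) ↔ _
    rcases a with i | i <;> rcases b with j | j
    · fin_cases i <;> fin_cases j <;> simp [bookGraph_adj_inl_inl, huc, huc.symm]
    · have := (e.symm j).2
      have := h1 _ this.1 this.2
      fin_cases i <;> simp [bookGraph_adj_inl_inr, this]
    · have := (e.symm i).2
      have := h1 _ this.1 this.2
      fin_cases j <;> simp [bookGraph_adj_inr_inl, this.1.symm, this.2.symm]
    · have hi := (e.symm i).2
      have hj := (e.symm j).2
      simp [not_bookGraph_adj_inr_inr, h2 _ _ hi.1 hi.2 hj.1 hj.2]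

end Book

/-! ### The main theorem -/

theorem theorem1p2 {V : Type*} [Fintype V] [DecidableEq V] (G : SimpleGraph V)
    [DecidableRel G.Adj] (m : ℕ) (hm : 57 ≤ m) (hedges : G.edgeFinset.card = m)
    (hisolated : ∀ v : V, ¬ G.IsIsolated v) (hfree : theta223.Free G) :
    graphSpectralRadius G ≤ (1 + √(4 * (m : ℝ) - 3)) / 2 ∧
      (graphSpectralRadius G = (1 + √(4 * (m : ℝ) - 3)) / 2 ↔
        ∃ k : ℕ, m = 2 * k + 1 ∧ Nonempty (G ≃g bookGraph k)) := by
  have hmR : (57 : ℝ) ≤ m := by exact_mod_cast hm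
  have hs : √(4 * (m : ℝ) - 3) ^ 2 = 4 * m - 3 := Real.sq_sqrt (by linarith)
  -- The bound `m ≥ 57` is exactly `4m - 3 ≥ 15²`, which puts `B` at 8 or more, as the cost
  -- estimates require.
  have hs15 : 15 ≤ √(4 * (m : ℝ) - 3) := Real.le_sqrt_of_sq_le (by linarith)
  set B : ℝ := (1 + √(4 * (m : ℝ) - 3)) / 2 with hB
  have hB8 : 8 ≤ B := by linarith
  have hBq : B ^ 2 - B = m - 1 := by
    rw [hB]
    linarith
  have hiso : ∀ v, ∃ w, G.Adj v w := by
    intro v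
    have := hisolated v
    simpa [SimpleGraph.IsIsolated] using this
  have hne : Nonempty V := by
    obtain ⟨e, -⟩ := Finset.card_pos.1 (by omega : 0 < G.edgeFinset.card)
    exact e.ind fun v _ => ⟨v⟩
  obtain ⟨x, u, hx0, hx1, hu, hx⟩ := exists_nonneg_eigenvector_graphSpectralRadius G
  have key := fun hr => sq_sub_self_le_card_sub_one hfree hiso (r := graphSpectralRadius G) hr
    hx0 hx1 hu hx
  rw [hedges] at key
  have hle : graphSpectralRadius G ≤ B := by
    by_contra! h
    have := (key (by linarith)).1
    nlinarith
  refine ⟨hle, fun heq => ?_, ?_⟩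
  · rw [heq] at key
    obtain ⟨c, hc⟩ := (key hB8).2 hBq
    obtain ⟨k, ⟨φ⟩⟩ := hc.exists_iso
    exact ⟨k, hedges ▸ card_edgeFinset_of_iso_bookGraph φ, ⟨φ⟩⟩
  · rintro ⟨k, hk, ⟨φ⟩⟩
    refine le_antisymm hle (le_graphSpectralRadius_of_iso_bookGraph φ (by linarith) ?_)
    rw [hBq, hk]
    push_cast
    ring
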